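/- **Conventions.** All spaces are finite-dimensional, nonzero complex Hilbert spaces $\mathbb C^d$, and operators on them are matrices. For a matrix $A$ and $B\ge 0$ put $A\star B:=B^{1/2}AB^{1/2}$. For $A>0$ and $B\ge 0$ let $A\# B:=A^{1/2}\bigl(A^{-1/2}BA^{-1/2}\bigr)^{1/2}A^{1/2}$ be the matrix geometric mean. For positive semidefinite (PSD) $P,Q$ let $\mathrm F(P,Q):=\operatorname{Tr}\sqrt{Q^{1/2}PQ^{1/2}}$ be the fidelity and $\mathrm B(P,Q):=\operatorname{Tr}[P+Q]-2\mathrm F(P,Q)$ the squared Bures distance. For a linear map $\Lambda$ from matrices on $\mathcal H$ to matrices on $\mathcal K$, with Hilbert–Schmidt adjoint $\Lambda^\dagger$, and $C$ PSD on $\mathcal K$, let $\Lambda^{-1}[C]:=\{Q\ge 0:\Lambda(Q)=C\}$, let $$\Pi_{\Lambda,C}[P]:=\operatorname*{argmin}_{Q\in\Lambda^{-1}[C]}\mathrm B(P,Q),\qquad \Pi^{\mathrm F}_{\Lambda,C}[P]:=\operatorname*{argmax}_{Q\in\Lambda^{-1}[C]}\mathrm F(P,Q)$$ be the sets of Bures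 and of fidelity projections of $P$, and, whenever $\Lambda(P)>0$, let the Gamma map be $\Gamma_{\Lambda,C}[P]:=P\star\bigl[\Lambda^\dagger(\Lambda(P)^{-1}\# C)\bigr]^2$. **Theorem.** 1. Let $\mathcal H=\mathcal X_1\otimes\cdots\otimes\mathcal X_n$, $\mathcal K=\mathcal X_k$ for some $k\in\{1,\dots,n\}$, $\mathcal L=\mathcal X_1\otimes\cdots\otimes\mathcal X_{k-1}$, $\mathcal R=\mathcal X_{k+1}\otimes\cdots\otimes\mathcal X_n$, and let $\operatorname{Tr}_{\mathcal H\backslash\mathcal K}$ be the partial trace over every factor except $\mathcal K$. For $M\ge 0$ on $\mathcal K$ write $A\star_{\mathcal K}M:=A\star(I_{\mathcal L}\otimes M\otimes I_{\mathcal R})$, and write $P_{\mathcal K}:=\operatorname{Tr}_{\mathcal H\backslash\mathcal K}[P]$. For all positive definite $P$ on $\mathcal H$ and $C$ on $\mathcal K$, $$\Gamma_{\operatorname{Tr}_{\mathcal H\backslash\mathcal K},C}[P]=P\star\bigl(I_{\mathcal L}\otimes(P_{\mathcal K}^{-1}\# C)\otimes I_{\mathcal R}\bigr)^2=P\star_{\mathcal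 K}(P_{\mathcal K}^{-1}\# C)^2\in\operatorname{Tr}_{\mathcal H\backslash\mathcal K}^{-1}[C],$$ and this matrix is the unique Bures projection and the unique fidelity projection: $$\Pi_{\operatorname{Tr}_{\mathcal H\backslash\mathcal K},C}[P]=\Pi^{\mathrm F}_{\operatorname{Tr}_{\mathcal H\backslash\mathcal K},C}[P]=\bigl\{P\star_{\mathcal K}(P_{\mathcal K}^{-1}\# C)^2\bigr\}.$$ 2. Let $P$ be positive definite on $\mathcal X\otimes\mathcal Y$, $P_{\mathcal X}:=\operatorname{Tr}_{\mathcal Y}[P]$, and $A\star_{\mathcal X}M:=A\star(M\otimes I_{\mathcal Y})$. For every positive definite $C$ on $\mathcal X$, $$\Pi_{\operatorname{Tr}_{\mathcal Y},C}[P]=\Pi^{\mathrm F}_{\operatorname{Tr}_{\mathcal Y},C}[P]=\bigl\{P\star_{\mathcal X}(P_{\mathcal X}^{-1}\# C)^2\bigr\},\qquad \Gamma_{\operatorname{Tr}_{\mathcal Y},C}[P]=P\star_{\mathcal X}(P_{\mathcal X}^{-1}\# C)^2 .$$ In particular, for $C=I_{\mathcal X}$, $$\Pi_{\operatorname{Tr}_{\mathcal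 Y},I_{\mathcal X}}[P]=\Pi^{\mathrm F}_{\operatorname{Tr}_{\mathcal Y},I_{\mathcal X}}[P]=\bigl\{P\star_{\mathcal X}P_{\mathcal X}^{-1}\bigr\},\qquad \Gamma_{\operatorname{Tr}_{\mathcal Y},I_{\mathcal X}}[P]=P\star_{\mathcal X}P_{\mathcal X}^{-1}.$$ 3. For the trace $\operatorname{Tr}$, regarded as a map to the matrices on $\mathcal K=\mathbb C$, every positive definite $P$ on $\mathcal H$ and every real $c\ge 0$, $$\Pi_{\operatorname{Tr},c}[P]=\Pi^{\mathrm F}_{\operatorname{Tr},c}[P]=\Bigl\{c\,\frac{P}{\operatorname{Tr}[P]}\Bigr\},\qquad \Gamma_{\operatorname{Tr},c}[P]=c\,\frac{P}{\operatorname{Tr}[P]}.$$ -/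

import Mathlib

open scoped Matrix MatrixOrder ComplexOrder Kronecker

namespace BuresProj

noncomputable section

section Basic

variable {H : Type*} [Fintype H] [DecidableEq H] {K : Type*} [Fintype K]

/-- The star product `A ⋆ B = B^{1/2} A B^{1/2}` (for `B ≥ 0`). -/
def starMul (A B : Matrix H H ℂ) : Matrix H H ℂ :=
  CFC.sqrt B * A * CFC.sqrt B

/-- The matrix geometric mean `A # B = A^{1/2} (A^{-1/2} B A^{-1/2})^{1/2} A^{1/2}`
(for `A > 0` and `B ≥ 0`). -/
def geomMean (A B : Matrix H H ℂ) : Matrix H H ℂ :=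
  CFC.sqrt A * CFC.sqrt ((CFC.sqrt A)⁻¹ * B * (CFC.sqrt A)⁻¹) * CFC.sqrt A

/-- The (square root) fidelity `F(P, Q) = Tr (Q^{1/2} P Q^{1/2})^{1/2}` of PSD matrices. -/
def fidelity (P Q : Matrix H H ℂ) : ℝ :=
  (CFC.sqrt (CFC.sqrt Q * P * CFC.sqrt Q)).trace.re

/-- The squared Bures distance `B(P, Q) = Tr (P + Q) - 2 F(P, Q)` of PSD matrices. -/
def bures (P Q : Matrix H H ℂ) : ℝ :=
  (P + Q).trace.re - 2 * fidelity P Q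

/-- The feasible set `Λ⁻¹[C]`: the PSD matrices `Q` with `Λ(Q) = C`. -/
def feasible (Λ : Matrix H H ℂ →ₗ[ℂ] Matrix K K ℂ) (C : Matrix K K ℂ) : Set (Matrix H H ℂ) :=
  {Q | Q.PosSemidef ∧ Λ Q = C}

/-- The set of Bures projections of `P`: all minimizers of `B(P, ·)` over `Λ⁻¹[C]`. -/
def buresProjection (Λ : Matrix H H ℂ →ₗ[ℂ] Matrix K K ℂ) (C : Matrix K K ℂ)
    (P : Matrix H H ℂ) : Set (Matrix H H ℂ) :=
  {Q | Q ∈ feasible Λ C ∧ ∀ Q' ∈ feasible Λ C, bures P Q ≤ bures P Q'}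

/-- The set of fidelity projections of `P`: all maximizers of `F(P, ·)` over `Λ⁻¹[C]`. -/
def fidelityProjection (Λ : Matrix H H ℂ →ₗ[ℂ] Matrix K K ℂ) (C : Matrix K K ℂ)
    (P : Matrix H H ℂ) : Set (Matrix H H ℂ) :=
  {Q | Q ∈ feasible Λ C ∧ ∀ Q' ∈ feasible Λ C, fidelity P Q' ≤ fidelity P Q}

/-- The adjoint `Λ†` of `Λ` for the Hilbert–Schmidt inner products `⟨A, B⟩ = Tr (Aᴴ B)`. Its
`(i, j)` entry at `Y` is `⟨E_ij, Λ†(Y)⟩ = ⟨Λ(E_ij), Y⟩`. -/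
def hsAdjoint (Λ : Matrix H H ℂ →ₗ[ℂ] Matrix K K ℂ) (Y : Matrix K K ℂ) : Matrix H H ℂ :=
  Matrix.of fun i j => ((Λ (Matrix.single i j 1))ᴴ * Y).trace

/-- The defining property of the adjoint: `⟨Λ†(Y), A⟩ = ⟨Y, Λ(A)⟩`. -/
theorem hsAdjoint_spec (Λ : Matrix H H ℂ →ₗ[ℂ] Matrix K K ℂ) (Y : Matrix K K ℂ)
    (A : Matrix H H ℂ) : ((hsAdjoint Λ Y)ᴴ * A).trace = (Yᴴ * Λ A).trace := by
  conv_rhs => rw [Matrix.matrix_eq_sum_single A]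
  have h : ∀ i j, Matrix.single i j (A i j) = A i j • (Matrix.single i j (1 : ℂ)) := by
    intro i j
    simp
  have h2 : ∀ i j, (Yᴴ * Λ (Matrix.single i j 1)).trace = (starRingEnd ℂ) (hsAdjoint Λ Y i j) := by
    intro i j
    have := Matrix.trace_conjTranspose ((Λ (Matrix.single i j 1))ᴴ * Y)
    simpa [hsAdjoint, Matrix.conjTranspose_mul] using this
  simp only [h, map_sum, map_smul, Finset.mul_sum, Matrix.trace_sum,
    Matrix.mul_smul, Matrix.trace_smul, h2]
  rw [Matrix.trace, Finset.sum_comm]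
  simp [Matrix.mul_apply, Matrix.diag, mul_comm]

variable [DecidableEq K]

/-- The Gamma map `Γ_{Λ,C}[P] = P ⋆ [Λ†(Λ(P)⁻¹ # C)]²`. -/
def gammaMap (Λ : Matrix H H ℂ →ₗ[ℂ] Matrix K K ℂ) (C : Matrix K K ℂ)
    (P : Matrix H H ℂ) : Matrix H H ℂ :=
  starMul P (hsAdjoint Λ (geomMean (Λ P)⁻¹ C) ^ 2)

end Basic

section Multipartite

/-! A multipartite space `X₁ ⊗ ⋯ ⊗ Xₙ` has the basis indexed by `∀ i, X i`, where `X i` indexes a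
basis of the `i`-th factor. -/

variable {n : ℕ} {X : Fin n → Type*} [∀ i, Fintype (X i)] [∀ i, DecidableEq (X i)]

/-- The matrix `I_L ⊗ M ⊗ I_R`, with `M` acting on the `k`-th factor and the identity on every
other factor. -/
def tensorId (k : Fin n) (M : Matrix (X k) (X k) ℂ) : Matrix (∀ i, X i) (∀ i, X i) ℂ :=
  Matrix.of fun x y => if ∀ i, i ≠ k → x i = y i then M (x k) (y k) else 0

/-- The partial trace that discards every factor except the `k`-th: the `(a, b)` entry sums the
entries `P x y` over the `x`, `y` with `x k = a`, `y k = b` and `x i = y i` for `i ≠ k`. -/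
def marginal (k : Fin n) :
    Matrix (∀ i, X i) (∀ i, X i) ℂ →ₗ[ℂ] Matrix (X k) (X k) ℂ where
  toFun P := Matrix.of fun a b =>
    ∑ x : (∀ i, X i), if x k = a then P x (Function.update x k b) else 0
  map_add' P Q := by
    ext a b
    simp [← Finset.sum_add_distrib, ← ite_add_zero]
  map_smul' c P := by
    ext a b
    simp [Finset.mul_sum]

/-- The star product on the `k`-th factor, `A ⋆_{X_k} M = A ⋆ (I_L ⊗ M ⊗ I_R)`. -/
def starAt (k : Fin n) (A : Matrix (∀ i, X i) (∀ i, X i) ℂ) (M : Matrix (X k) (X k) ℂ) :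
    Matrix (∀ i, X i) (∀ i, X i) ℂ :=
  starMul A (tensorId k M)

end Multipartite

section Bipartite

variable {X Y : Type*} [Fintype X] [DecidableEq X] [Fintype Y] [DecidableEq Y]

/-- The partial trace `Tr_Y`, whose value at `P` is the marginal `P_X`. -/
def marginalX : Matrix (X × Y) (X × Y) ℂ →ₗ[ℂ] Matrix X X ℂ where
  toFun P := Matrix.of fun a b => ∑ y, P (a, y) (b, y)
  map_add' P Q := by
    ext a b
    simp [Finset.sum_add_distrib]
  map_smul' c P := by
    ext a b
    simp [Finset.mul_sum]

/-- The star product on the first factor, `A ⋆_X M = A ⋆ (M ⊗ I_Y)`. -/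
def starX (A : Matrix (X × Y) (X × Y) ℂ) (M : Matrix X X ℂ) : Matrix (X × Y) (X × Y) ℂ :=
  starMul A (M ⊗ₖ (1 : Matrix Y Y ℂ))

end Bipartite

section Trace

variable {H : Type*} [Fintype H]

/-- The trace as a map to the `1 × 1` matrices, that is, to the matrices on `K = ℂ`. -/
def traceMap : Matrix H H ℂ →ₗ[ℂ] Matrix Unit Unit ℂ where
  toFun P := Matrix.of fun _ _ => P.trace
  map_add' P Q := by
    ext
    simp [Matrix.trace_add]
  map_smul' c P := by
    ext
    simp [Matrix.trace_smul]

/-- A scalar as a `1 × 1` matrix. -/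
def scalar (c : ℝ) : Matrix Unit Unit ℂ :=
  Matrix.of fun _ _ => (c : ℂ)

end Trace

end

end BuresProj

namespace BuresProj

/-! ### Fidelity, the geometric mean and Alberti's bound. -/

section Fidelity

variable {H : Type*} [Fintype H]

/-! Each of the three maps `Λ` satisfies `Tr (J(M) Q) = Tr (M Λ(Q))` for a unital star homomorphism
`J` (tensoring with identities, or `m ↦ m I`), so `Λ† = J`. Put `Y = Λ(P)⁻¹ # C` and `X = J(Y)`;
then `Γ[P] = X P X`. It is feasible because `Λ(J(M) Q J(M)) = M Λ(Q) M` (`map_conj`) and `Y` solves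
the Riccati equation `Y Λ(P) Y = C`.

For optimality, Alberti's bound `2 F(P, Q) ≤ Tr X⁻¹Q + Tr XP` holds for every `X > 0`, with equality
only at `Q = X P X`. For `C > 0` the matrix `X = J(Y)` is positive definite, and `Tr X⁻¹Q = Tr Y⁻¹C`
for every feasible `Q`. The bound is then constant on the feasible set and attained exactly at `X P
X`.

Since `J` is unital, `Tr Q = Tr C` on the feasible set, so minimizing the Bures distance is the same
as maximizing the fidelity. The singular case `c = 0` of the trace has feasible set `{0}`. -/

theorem posSemidef_mul_mul {A W : Matrix H H ℂ} (hA : A.PosSemidef) (hW : Wᴴ = W) :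
    (W * A * W).PosSemidef := by
  simpa [hW] using hA.mul_mul_conjTranspose_same W

theorem trace_conj_re_nonneg {P : Matrix H H ℂ} (hP : P.PosSemidef) (A : Matrix H H ℂ) :
    0 ≤ (A * P * Aᴴ).trace.re :=
  (Complex.le_def.mp (hP.mul_mul_conjTranspose_same A).trace_nonneg).1

variable [DecidableEq H]

theorem posSemidef_sqrt (A : Matrix H H ℂ) : (CFC.sqrt A).PosSemidef :=
  Matrix.nonneg_iff_posSemidef.mp (CFC.sqrt_nonneg A)

theorem isHermitian_sqrt (A : Matrix H H ℂ) : (CFC.sqrt A)ᴴ = CFC.sqrt A :=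
  (posSemidef_sqrt A).isHermitian

theorem sqrt_mul_sqrt {A : Matrix H H ℂ} (hA : A.PosSemidef) : CFC.sqrt A * CFC.sqrt A = A :=
  CFC.sqrt_mul_sqrt_self A hA.nonneg

theorem posDef_sqrt {A : Matrix H H ℂ} (hA : A.PosDef) : (CFC.sqrt A).PosDef :=
  (posSemidef_sqrt A).posDef_iff_isUnit.mpr
    ((CFC.isUnit_sqrt_iff A hA.posSemidef.nonneg).mpr hA.isUnit)

/-- The trace of the square root only depends on the characteristic polynomial. -/
theorem trace_sqrt_eq_of_charpoly_eq {A B : Matrix H H ℂ} (hA : A.PosSemidef) (hB : B.PosSemidef)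
    (h : A.charpoly = B.charpoly) : (CFC.sqrt A).trace = (CFC.sqrt B).trace := by
  have e : hA.1.eigenvalues = hB.1.eigenvalues :=
    (Matrix.IsHermitian.eigenvalues_eq_eigenvalues_iff hA.1 hB.1).mpr h
  have key : (CFC.sqrt A).charpoly = (CFC.sqrt B).charpoly := by
    rw [CFC.sqrt_eq_real_sqrt A hA.nonneg, CFC.sqrt_eq_real_sqrt B hB.nonneg,
      cfcₙ_eq_cfc, cfcₙ_eq_cfc, hA.1.charpoly_cfc_eq, hB.1.charpoly_cfc_eq, e]
  rw [Matrix.trace_eq_neg_charpoly_nextCoeff, Matrix.trace_eq_neg_charpoly_nextCoeff, key]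

/-- The matrices under the two roots are `A Aᴴ` and `Aᴴ A` for `A = Q^{1/2} P^{1/2}`, which share a
characteristic polynomial. -/
theorem fidelity_comm {P Q : Matrix H H ℂ} (hP : P.PosSemidef) (hQ : Q.PosSemidef) :
    fidelity P Q = fidelity Q P := by
  unfold fidelity
  congr 1
  refine trace_sqrt_eq_of_charpoly_eq (posSemidef_mul_mul hP (isHermitian_sqrt Q))
    (posSemidef_mul_mul hQ (isHermitian_sqrt P)) ?_
  have h1 : CFC.sqrt Q * P * CFC.sqrt Q
      = (CFC.sqrt Q * CFC.sqrt P) * (CFC.sqrt P * CFC.sqrt Q) := by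
    conv_lhs => rw [← sqrt_mul_sqrt hP]
    noncomm_ring
  have h2 : CFC.sqrt P * Q * CFC.sqrt P
      = (CFC.sqrt P * CFC.sqrt Q) * (CFC.sqrt Q * CFC.sqrt P) := by
    conv_lhs => rw [← sqrt_mul_sqrt hQ]
    noncomm_ring
  rw [h1, h2, Matrix.charpoly_mul_comm]

/-- After exchanging the arguments, the matrix under the root is the perfect square `(P^{1/2} W
P^{1/2})²`. -/
theorem fidelity_conj {P W : Matrix H H ℂ} (hP : P.PosSemidef) (hW : W.PosSemidef) :
    fidelity P (W * P * W) = (W * P).trace.re := by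
  rw [fidelity_comm hP (posSemidef_mul_mul hP hW.1), fidelity]
  have h : CFC.sqrt (CFC.sqrt P * (W * P * W) * CFC.sqrt P) = CFC.sqrt P * W * CFC.sqrt P := by
    refine CFC.sqrt_unique ?_ (posSemidef_mul_mul hW (isHermitian_sqrt P)).nonneg
    conv_rhs => rw [← sqrt_mul_sqrt hP]
    simp only [mul_assoc]
    rw [sqrt_mul_sqrt hP]
  rw [h, mul_assoc, Matrix.trace_mul_comm, mul_assoc, sqrt_mul_sqrt hP]

/-- The Riccati equation of the geometric mean. -/
theorem geomMean_mul_mul {A B : Matrix H H ℂ} (hA : A.PosDef) (hB : B.PosSemidef) :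
    geomMean A B * A⁻¹ * geomMean A B = B := by
  have hS := (posDef_sqrt hA).isUnit
  have hdet := (Matrix.isUnit_iff_isUnit_det _).mp hS
  have hinv : A⁻¹ = (CFC.sqrt A)⁻¹ * (CFC.sqrt A)⁻¹ := by
    rw [← Matrix.mul_inv_rev, sqrt_mul_sqrt hA.posSemidef]
  have hT : ((CFC.sqrt A)⁻¹ * B * (CFC.sqrt A)⁻¹).PosSemidef :=
    posSemidef_mul_mul hB (posDef_sqrt hA).inv.1
  have hTT := sqrt_mul_sqrt hT
  unfold geomMean
  rw [hinv]
  generalize CFC.sqrt ((CFC.sqrt A)⁻¹ * B * (CFC.sqrt A)⁻¹) = T at hTT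
  generalize CFC.sqrt A = S at *
  calc S * T * S * (S⁻¹ * S⁻¹) * (S * T * S)
      = S * T * (S * S⁻¹) * (S⁻¹ * S) * T * S := by noncomm_ring
    _ = S * (T * T) * S := by
      rw [Matrix.mul_nonsing_inv _ hdet, Matrix.nonsing_inv_mul _ hdet]; noncomm_ring
    _ = (S * S⁻¹) * B * (S⁻¹ * S) := by rw [hTT]; noncomm_ring
    _ = B := by rw [Matrix.mul_nonsing_inv _ hdet, Matrix.nonsing_inv_mul _ hdet]; simp

theorem posSemidef_geomMean (A B : Matrix H H ℂ) : (geomMean A B).PosSemidef :=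
  posSemidef_mul_mul (posSemidef_sqrt _) (isHermitian_sqrt A)

/-- By the Riccati equation, a singular mean would force `det B = 0`. -/
theorem posDef_geomMean {A B : Matrix H H ℂ} (hA : A.PosDef) (hB : B.PosDef) :
    (geomMean A B).PosDef := by
  rw [(posSemidef_geomMean A B).posDef_iff_det_ne_zero]
  intro h
  have := congrArg Matrix.det (geomMean_mul_mul hA hB.posSemidef)
  rw [Matrix.det_mul, h, mul_zero] at this
  exact hB.posSemidef.posDef_iff_det_ne_zero.mp hB this.symm

/-- Here `A # I = A^{1/2}`; this simplifies the formula when `C = I`. -/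
theorem geomMean_one_sq {A : Matrix H H ℂ} (hA : A.PosDef) : geomMean A 1 ^ 2 = A := by
  have hS := posDef_sqrt hA
  have hdet := (Matrix.isUnit_iff_isUnit_det _).mp hS.isUnit
  rw [geomMean, mul_one, CFC.sqrt_mul_self _ hS.inv.posSemidef.nonneg,
    Matrix.mul_nonsing_inv _ hdet, one_mul, sq, sqrt_mul_sqrt hA.posSemidef]

theorem eq_zero_of_trace_conj_re_eq_zero {P A : Matrix H H ℂ} (hP : P.PosDef)
    (h : (A * P * Aᴴ).trace.re = 0) : A = 0 := by
  have h0 : (A * P * Aᴴ).trace = 0 := by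
    apply Complex.ext h
    exact (Complex.le_def.mp (hP.posSemidef.mul_mul_conjTranspose_same A).trace_nonneg).2.symm
  have h1 : A * P * Aᴴ = (A * CFC.sqrt P) * (A * CFC.sqrt P)ᴴ := by
    rw [Matrix.conjTranspose_mul, isHermitian_sqrt]
    conv_lhs => rw [← sqrt_mul_sqrt hP.posSemidef]
    noncomm_ring
  rw [h1, Matrix.trace_mul_conjTranspose_self_eq_zero_iff] at h0
  exact (posDef_sqrt hP).isUnit.mul_left_eq_zero.mp h0

/-- Every PSD matrix is `W P W` for some PSD `W`, when `P` is positive definite. -/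
theorem exists_conj_eq {P Q : Matrix H H ℂ} (hP : P.PosDef) (hQ : Q.PosSemidef) :
    ∃ W : Matrix H H ℂ, W.PosSemidef ∧ W * P * W = Q := by
  refine ⟨geomMean P⁻¹ Q, posSemidef_geomMean _ _, ?_⟩
  have := geomMean_mul_mul hP.inv hQ
  rwa [Matrix.nonsing_inv_nonsing_inv _ ((Matrix.isUnit_iff_isUnit_det _).mp hP.isUnit)] at this

/-- Completing the square: with `Q = W P W`, the right side is the gap in Alberti's bound, and the
left side is `Tr X⁻¹(W - X)P(W - X)`. Its sign gives the bound, its vanishing the equality case. -/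
theorem trace_gap {P W X : Matrix H H ℂ} (hW : W.PosSemidef) (hX : X.PosDef) :
    ((CFC.sqrt X⁻¹ * (W - X)) * P * (CFC.sqrt X⁻¹ * (W - X))ᴴ).trace.re
      = (X⁻¹ * (W * P * W)).trace.re + (X * P).trace.re - 2 * (W * P).trace.re := by
  have hdet := (Matrix.isUnit_iff_isUnit_det _).mp hX.isUnit
  have hc : (CFC.sqrt X⁻¹ * (W - X))ᴴ = (W - X) * CFC.sqrt X⁻¹ := by
    rw [Matrix.conjTranspose_mul, isHermitian_sqrt, Matrix.conjTranspose_sub, hW.1.eq, hX.1.eq]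
  have h1 : ((CFC.sqrt X⁻¹ * (W - X)) * P * (CFC.sqrt X⁻¹ * (W - X))ᴴ).trace
      = (X⁻¹ * ((W - X) * P * (W - X))).trace := by
    rw [hc, show CFC.sqrt X⁻¹ * (W - X) * P * ((W - X) * CFC.sqrt X⁻¹)
      = (CFC.sqrt X⁻¹ * ((W - X) * P * (W - X))) * CFC.sqrt X⁻¹ by noncomm_ring,
      Matrix.trace_mul_comm, ← mul_assoc, sqrt_mul_sqrt hX.inv.posSemidef]
  have h2 : X⁻¹ * ((W - X) * P * (W - X))
      = X⁻¹ * (W * P * W) + (X⁻¹ * X) * P * X - (X⁻¹ * X) * P * W - X⁻¹ * (W * P * X) := by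
    noncomm_ring
  have h3 : (X⁻¹ * (W * P * X)).trace = (W * P).trace := by
    rw [Matrix.trace_mul_comm, mul_assoc, Matrix.mul_nonsing_inv _ hdet, mul_one]
  rw [h1, h2, Matrix.nonsing_inv_mul _ hdet, one_mul, Matrix.trace_sub, Matrix.trace_sub,
    Matrix.trace_add, h3, Matrix.trace_mul_comm P X, Matrix.trace_mul_comm P W]
  simp only [Complex.sub_re, Complex.add_re]
  ring

/-- Alberti's upper bound on the fidelity. -/
theorem two_mul_fidelity_le {P Q X : Matrix H H ℂ} (hP : P.PosDef) (hQ : Q.PosSemidef)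
    (hX : X.PosDef) : 2 * fidelity P Q ≤ (X⁻¹ * Q).trace.re + (X * P).trace.re := by
  obtain ⟨W, hW, rfl⟩ := exists_conj_eq hP hQ
  rw [fidelity_conj hP.posSemidef hW]
  have := trace_gap (P := P) hW hX
  have := trace_conj_re_nonneg hP.posSemidef (CFC.sqrt X⁻¹ * (W - X))
  linarith

theorem eq_conj_of_two_mul_fidelity_eq {P Q X : Matrix H H ℂ} (hP : P.PosDef) (hQ : Q.PosSemidef)
    (hX : X.PosDef) (h : 2 * fidelity P Q = (X⁻¹ * Q).trace.re + (X * P).trace.re) :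
    Q = X * P * X := by
  obtain ⟨W, hW, rfl⟩ := exists_conj_eq hP hQ
  rw [fidelity_conj hP.posSemidef hW] at h
  have h1 : CFC.sqrt X⁻¹ * (W - X) = 0 := by
    apply eq_zero_of_trace_conj_re_eq_zero hP
    rw [trace_gap hW hX]
    linarith
  have h2 : W - X = 0 := (posDef_sqrt hX.inv).isUnit.mul_right_eq_zero.mp h1
  rw [sub_eq_zero.mp h2]

theorem trace_inv_mul_conj {P X : Matrix H H ℂ} (hX : X.PosDef) :
    (X⁻¹ * (X * P * X)).trace = (X * P).trace := by
  have hdet := (Matrix.isUnit_iff_isUnit_det _).mp hX.isUnit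
  rw [Matrix.trace_mul_comm, mul_assoc, Matrix.mul_nonsing_inv _ hdet, mul_one]

/-- If the trace is constant on the feasible set, the two projections agree. -/
theorem buresProjection_eq_fidelityProjection {K : Type*} [Fintype K] {P : Matrix H H ℂ}
    {Λ : Matrix H H ℂ →ₗ[ℂ] Matrix K K ℂ} {C : Matrix K K ℂ} {t : ℂ}
    (ht : ∀ Q ∈ feasible Λ C, Q.trace = t) :
    buresProjection Λ C P = fidelityProjection Λ C P := by
  ext Q
  refine and_congr_right fun hQ => forall₂_congr fun Q' hQ' => ?_
  rw [bures, bures, Matrix.trace_add, Matrix.trace_add, ht Q hQ, ht Q' hQ']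
  constructor <;> intro h <;> linarith

theorem fidelityProjection_eq_singleton {K : Type*} [Fintype K] {P X : Matrix H H ℂ}
    {Λ : Matrix H H ℂ →ₗ[ℂ] Matrix K K ℂ} {C : Matrix K K ℂ} {t : ℂ} (hP : P.PosDef)
    (hX : X.PosDef) (hG : X * P * X ∈ feasible Λ C)
    (ht : ∀ Q ∈ feasible Λ C, (X⁻¹ * Q).trace = t) :
    fidelityProjection Λ C P = {X * P * X} := by
  -- Evaluating the constant `t` at the candidate itself shows that the bound equals `2 F(P, X P
  -- X)`.
  have e : t.re = (X * P).trace.re := by rw [← ht _ hG, trace_inv_mul_conj hX]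
  have hF := fidelity_conj hP.posSemidef hX.posSemidef
  ext Q
  rw [Set.mem_singleton_iff]
  constructor
  · rintro ⟨hQ, hmax⟩
    refine eq_conj_of_two_mul_fidelity_eq hP hQ.1 hX (le_antisymm ?_ ?_)
    · exact two_mul_fidelity_le hP hQ.1 hX
    · have := hmax _ hG
      rw [ht Q hQ]
      linarith
  · rintro rfl
    refine ⟨hG, fun Q' hQ' => ?_⟩
    have := two_mul_fidelity_le hP hQ'.1 hX
    rw [ht Q' hQ'] at this
    linarith

end Fidelity

/-! ### Maps adjoint to a unital star homomorphism. -/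

section Representation

variable {H : Type*} [Fintype H] [DecidableEq H] {K : Type*} [Fintype K] [DecidableEq K]
  {J : Matrix K K ℂ →⋆ₐ[ℂ] Matrix H H ℂ} {Λ : Matrix H H ℂ →ₗ[ℂ] Matrix K K ℂ}

theorem map_conjTranspose (J : Matrix K K ℂ →⋆ₐ[ℂ] Matrix H H ℂ) (M : Matrix K K ℂ) :
    J Mᴴ = (J M)ᴴ :=
  map_star J M

theorem posSemidef_map (J : Matrix K K ℂ →⋆ₐ[ℂ] Matrix H H ℂ) {M : Matrix K K ℂ}
    (hM : M.PosSemidef) : (J M).PosSemidef := by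
  rw [← sqrt_mul_sqrt hM, map_mul]
  nth_rw 1 [← isHermitian_sqrt M]
  rw [map_conjTranspose]
  exact Matrix.posSemidef_conjTranspose_mul_self _

theorem posDef_map (J : Matrix K K ℂ →⋆ₐ[ℂ] Matrix H H ℂ) {M : Matrix K K ℂ} (hM : M.PosDef) :
    (J M).PosDef :=
  (posSemidef_map J hM.posSemidef).posDef_iff_isUnit.mpr (hM.isUnit.map J)

theorem map_nonsing_inv (J : Matrix K K ℂ →⋆ₐ[ℂ] Matrix H H ℂ) {M : Matrix K K ℂ} (hM : M.PosDef) :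
    J M⁻¹ = (J M)⁻¹ := by
  refine (Matrix.inv_eq_left_inv ?_).symm
  rw [← map_mul, Matrix.nonsing_inv_mul _ ((Matrix.isUnit_iff_isUnit_det _).mp hM.isUnit), map_one]

theorem starMul_sq {A X : Matrix H H ℂ} (hX : X.PosSemidef) :
    starMul A (X ^ 2) = X * A * X := by
  rw [starMul, CFC.sqrt_sq X hX.nonneg]

theorem hsAdjoint_eq (hJ : ∀ M Q, (J M * Q).trace = (M * Λ Q).trace) (M : Matrix K K ℂ) :
    hsAdjoint Λ M = J M := by
  rw [← Matrix.conjTranspose_inj, Matrix.ext_iff_trace_mul_right]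
  intro A
  rw [hsAdjoint_spec, ← hJ, map_conjTranspose]

/-- Tested against every `Z` under the trace, this is multiplicativity of `J` and cyclicity. -/
theorem map_conj (hJ : ∀ M Q, (J M * Q).trace = (M * Λ Q).trace) (M : Matrix K K ℂ)
    (Q : Matrix H H ℂ) : Λ (J M * Q * J M) = M * Λ Q * M := by
  rw [Matrix.ext_iff_trace_mul_left]
  intro Z
  rw [← hJ, show J Z * (J M * Q * J M) = (J Z * J M * Q) * J M by noncomm_ring,
    Matrix.trace_mul_comm, show J M * (J Z * J M * Q) = J (M * Z * M) * Q by
      simp only [map_mul, mul_assoc], hJ, show Z * (M * Λ Q * M) = (Z * M * Λ Q) * M by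
      noncomm_ring, Matrix.trace_mul_comm _ M]
  simp only [mul_assoc]

/-- With `V = x xᴴ`, the quadratic form is `Tr (J(V) P) ≥ 0`. If it vanishes then `J(V^{1/2}) = 0`,
and injectivity of `J` gives `x = 0`. -/
theorem posDef_of_trace_eq [Nonempty H] (hJ : ∀ M Q, (J M * Q).trace = (M * Λ Q).trace)
    {P : Matrix H H ℂ} (hP : P.PosDef) : (Λ P).PosDef := by
  have hJinj : Function.Injective J := by
    intro A B hAB
    cases isEmpty_or_nonempty K
    · exact Subsingleton.elim _ _
    -- A full matrix ring over a field is simple, and `Nonempty H` makes the target nontrivial.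
    · exact RingHom.injective (J : Matrix K K ℂ →+* Matrix H H ℂ) hAB
  have hherm : (Λ P).IsHermitian := by
    rw [Matrix.IsHermitian, Matrix.ext_iff_trace_mul_left]
    intro Z
    rw [← hJ, ← Matrix.trace_mul_comm, ← Matrix.conjTranspose_conjTranspose Z,
      ← Matrix.conjTranspose_mul, Matrix.trace_conjTranspose, ← hJ, map_conjTranspose,
      map_conjTranspose, ← Matrix.trace_conjTranspose, Matrix.conjTranspose_mul, hP.1.eq,
      Matrix.trace_mul_comm, map_conjTranspose]
  refine Matrix.PosDef.of_dotProduct_mulVec_pos hherm fun x hx => ?_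
  have hV := Matrix.posSemidef_vecMulVec_self_star x
  have e : star x ⬝ᵥ Λ P *ᵥ x = (J (CFC.sqrt (Matrix.vecMulVec x (star x))) * P
      * (J (CFC.sqrt (Matrix.vecMulVec x (star x))))ᴴ).trace := by
    rw [← map_conjTranspose, isHermitian_sqrt, Matrix.trace_mul_comm, ← mul_assoc, ← map_mul,
      sqrt_mul_sqrt hV, hJ, Matrix.trace_mul_comm, Matrix.mul_vecMulVec, Matrix.trace_vecMulVec,
      dotProduct_comm]
  rw [e]
  refine lt_of_le_of_ne (hP.posSemidef.mul_mul_conjTranspose_same _).trace_nonneg fun h0 => hx ?_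
  have h1 := eq_zero_of_trace_conj_re_eq_zero hP (congrArg Complex.re h0.symm)
  have h2 : CFC.sqrt (Matrix.vecMulVec x (star x)) = 0 := hJinj (h1.trans (map_zero J).symm)
  have h3 : Matrix.vecMulVec x (star x) = 0 := by rw [← sqrt_mul_sqrt hV, h2, mul_zero]
  simpa [Matrix.vecMulVec_eq_zero] using h3

theorem gammaMap_eq (hJ : ∀ M Q, (J M * Q).trace = (M * Λ Q).trace) (P : Matrix H H ℂ)
    (C : Matrix K K ℂ) :
    gammaMap Λ C P = J (geomMean (Λ P)⁻¹ C) * P * J (geomMean (Λ P)⁻¹ C) := by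
  rw [gammaMap, hsAdjoint_eq hJ, starMul_sq (posSemidef_map J (posSemidef_geomMean _ _))]

theorem gammaMap_eq_starMul (hJ : ∀ M Q, (J M * Q).trace = (M * Λ Q).trace) (P : Matrix H H ℂ)
    (C : Matrix K K ℂ) :
    gammaMap Λ C P = starMul P (J (geomMean (Λ P)⁻¹ C ^ 2)) := by
  rw [gammaMap, hsAdjoint_eq hJ, map_pow]

theorem geomMean_inv_conj [Nonempty H] (hJ : ∀ M Q, (J M * Q).trace = (M * Λ Q).trace)
    {P : Matrix H H ℂ} (hP : P.PosDef) {C : Matrix K K ℂ} (hC : C.PosSemidef) :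
    geomMean (Λ P)⁻¹ C * Λ P * geomMean (Λ P)⁻¹ C = C := by
  have hΛ := posDef_of_trace_eq hJ hP
  have := geomMean_mul_mul hΛ.inv hC
  rwa [Matrix.nonsing_inv_nonsing_inv _ ((Matrix.isUnit_iff_isUnit_det _).mp hΛ.isUnit)] at this

theorem gammaMap_mem_feasible [Nonempty H] (hJ : ∀ M Q, (J M * Q).trace = (M * Λ Q).trace)
    {P : Matrix H H ℂ} (hP : P.PosDef) {C : Matrix K K ℂ} (hC : C.PosSemidef) :
    gammaMap Λ C P ∈ feasible Λ C := by
  rw [gammaMap_eq hJ]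
  refine ⟨posSemidef_mul_mul hP.posSemidef (posSemidef_map J (posSemidef_geomMean _ _)).1, ?_⟩
  rw [map_conj hJ, geomMean_inv_conj hJ hP hC]

theorem trace_of_mem_feasible (hJ : ∀ M Q, (J M * Q).trace = (M * Λ Q).trace)
    {C : Matrix K K ℂ} {Q : Matrix H H ℂ} (hQ : Q ∈ feasible Λ C) : Q.trace = C.trace := by
  have := hJ 1 Q
  rwa [map_one, one_mul, one_mul, hQ.2] at this

theorem fidelityProjection_eq_gammaMap [Nonempty H]
    (hJ : ∀ M Q, (J M * Q).trace = (M * Λ Q).trace)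
    {P : Matrix H H ℂ} (hP : P.PosDef) {C : Matrix K K ℂ} (hC : C.PosDef) :
    fidelityProjection Λ C P = {gammaMap Λ C P} := by
  have hY := posDef_geomMean (posDef_of_trace_eq hJ hP).inv hC
  have hG := gammaMap_mem_feasible hJ hP hC.posSemidef
  rw [gammaMap_eq hJ] at hG ⊢
  refine fidelityProjection_eq_singleton (t := ((geomMean (Λ P)⁻¹ C)⁻¹ * C).trace) hP
    (posDef_map J hY) hG fun Q hQ => ?_
  rw [← map_nonsing_inv J hY, hJ, hQ.2]

theorem buresProjection_eq_gammaMap [Nonempty H]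
    (hJ : ∀ M Q, (J M * Q).trace = (M * Λ Q).trace)
    {P : Matrix H H ℂ} (hP : P.PosDef) {C : Matrix K K ℂ} (hC : C.PosDef) :
    buresProjection Λ C P = {gammaMap Λ C P} := by
  rw [buresProjection_eq_fidelityProjection fun Q hQ => trace_of_mem_feasible hJ hQ,
    fidelityProjection_eq_gammaMap hJ hP hC]

end Representation

/-! ### Partial trace onto one of `n` factors. -/

section Multipartite

variable {n : ℕ} {X : Fin n → Type*} [∀ i, Fintype (X i)] [∀ i, DecidableEq (X i)]

/-- The indices agreeing with `x` off `k` are exactly the updates of `x` at `k`. -/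
theorem sum_ite_agree_off (k : Fin n) (x : ∀ i, X i) (f : (∀ i, X i) → ℂ) :
    (∑ y, if ∀ i, i ≠ k → x i = y i then f y else 0) = ∑ a, f (Function.update x k a) := by
  rw [← Finset.sum_filter]
  refine Finset.sum_nbij' (fun y => y k) (fun a => Function.update x k a) (by simp) ?_ ?_
    (by simp) ?_
  · intro a _
    simp +contextual
  · intro y hy
    ext i
    rcases eq_or_ne i k with rfl | h
    · simp
    · simpa [h] using (Finset.mem_filter.mp hy).2 i h
  · intro y hy
    congr 1
    ext i
    rcases eq_or_ne i k with rfl | h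
    · simp
    · simpa [h] using ((Finset.mem_filter.mp hy).2 i h).symm

/-- `tensorId k` as a star algebra homomorphism. -/
def tensorIdHom (k : Fin n) :
    Matrix (X k) (X k) ℂ →⋆ₐ[ℂ] Matrix (∀ i, X i) (∀ i, X i) ℂ where
  toFun := tensorId k
  map_one' := by
    ext x y
    simp only [tensorId, Matrix.of_apply, Matrix.one_apply, ← ite_and]
    refine if_congr ⟨fun h => ?_, by rintro rfl; simp⟩ rfl rfl
    ext i
    rcases eq_or_ne i k with rfl | hi
    · exact h.2
    · exact h.1 i hi
  map_mul' M N := by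
    ext x z
    simp only [tensorId, Matrix.of_apply, Matrix.mul_apply, ite_mul, zero_mul]
    rw [sum_ite_agree_off]
    have h : ∀ a, (∀ i, i ≠ k → Function.update x k a i = z i) ↔ ∀ i, i ≠ k → x i = z i :=
      fun a => forall₂_congr fun i hi => by rw [Function.update_of_ne hi]
    simp only [h, Function.update_self]
    split_ifs <;> simp
  map_zero' := by
    ext
    simp [tensorId]
  map_add' M N := by
    ext
    simp only [tensorId, Matrix.of_apply, Matrix.add_apply]
    split_ifs <;> simp
  commutes' c := by
    ext x y
    simp only [tensorId, Matrix.of_apply, Matrix.algebraMap_matrix_apply, ← ite_and]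
    refine if_congr ⟨fun h => ?_, by rintro rfl; simp⟩ rfl rfl
    ext i
    rcases eq_or_ne i k with rfl | hi
    · exact h.2
    · exact h.1 i hi
  map_star' M := by
    ext x y
    simp only [tensorId, Matrix.of_apply, Matrix.star_apply, eq_comm (a := x _)]
    split_ifs <;> simp

theorem trace_tensorId_mul (k : Fin n) (M : Matrix (X k) (X k) ℂ)
    (Q : Matrix (∀ i, X i) (∀ i, X i) ℂ) :
    (tensorIdHom k M * Q).trace = (M * marginal k Q).trace := by
  change (tensorId k M * Q).trace = _
  rw [Matrix.trace_mul_comm, Matrix.trace_mul_comm M]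
  have h : ∀ x, (Q * tensorId k M) x x
      = ∑ a, Q x (Function.update x k a) * M a (x k) := by
    intro x
    simp only [Matrix.mul_apply, tensorId, Matrix.of_apply, mul_ite, mul_zero,
      eq_comm (b := x _)]
    rw [sum_ite_agree_off]
    simp
  simp only [Matrix.trace, Matrix.diag_apply, h]
  simp only [Matrix.mul_apply, marginal, LinearMap.coe_mk, AddHom.coe_mk, Matrix.of_apply,
    Finset.sum_mul, ite_mul, zero_mul]
  rw [Finset.sum_comm]
  conv_rhs => rw [Finset.sum_comm]
  refine Finset.sum_congr rfl fun a _ => ?_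
  conv_rhs => rw [Finset.sum_comm]
  simp

end Multipartite

/-! ### Partial trace over the second of two factors. -/

section Bipartite

variable {X Y : Type*} [Fintype X] [DecidableEq X] [Fintype Y] [DecidableEq Y]

/-- `M ↦ M ⊗ I_Y` as a star algebra homomorphism. -/
noncomputable def kroneckerOneHom : Matrix X X ℂ →⋆ₐ[ℂ] Matrix (X × Y) (X × Y) ℂ where
  toFun M := M ⊗ₖ (1 : Matrix Y Y ℂ)
  map_one' := Matrix.one_kronecker_one
  map_mul' M N := by rw [← Matrix.mul_kronecker_mul, one_mul]
  map_zero' := Matrix.zero_kronecker _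
  map_add' M N := Matrix.add_kronecker _ _ _
  commutes' c := by
    rw [Algebra.algebraMap_eq_smul_one, Algebra.algebraMap_eq_smul_one, Matrix.smul_kronecker,
      Matrix.one_kronecker_one]
  map_star' M := by
    simp [Matrix.star_eq_conjTranspose, Matrix.conjTranspose_kronecker]

theorem trace_kronecker_one_mul (M : Matrix X X ℂ) (Q : Matrix (X × Y) (X × Y) ℂ) :
    (kroneckerOneHom M * Q).trace = (M * marginalX Q).trace := by
  change ((M ⊗ₖ (1 : Matrix Y Y ℂ)) * Q).trace = _
  simp only [Matrix.trace, Matrix.diag_apply, Matrix.mul_apply, marginalX, LinearMap.coe_mk,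
    AddHom.coe_mk, Matrix.of_apply, Fintype.sum_prod_type, Matrix.kronecker_apply,
    Matrix.one_apply, Finset.mul_sum]
  refine Finset.sum_congr rfl fun a _ => ?_
  rw [Finset.sum_comm]
  simp

end Bipartite

/-! ### Trace normalization, including `c = 0`. -/

section Trace

variable {H : Type*} [Fintype H]

/-- This covers `c = 0`, where the optimality argument, which needs `C > 0`, does not apply. -/
theorem feasible_traceMap_zero : feasible (traceMap (H := H)) (scalar 0) = {0} := by
  ext Q
  rw [Set.mem_singleton_iff]
  constructor
  · rintro ⟨hQ, h⟩
    have := congrFun₂ h () ()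
    exact hQ.trace_eq_zero_iff.mp (by simpa [traceMap, scalar] using this)
  · rintro rfl
    refine ⟨.zero, ?_⟩
    ext
    simp [scalar]

variable [DecidableEq H]

/-- `M ↦ m I` for a `1 × 1` matrix `M = (m)`, as a star algebra homomorphism. -/
noncomputable def scalarHom : Matrix Unit Unit ℂ →⋆ₐ[ℂ] Matrix H H ℂ where
  toFun M := M () () • 1
  map_one' := by simp
  map_mul' M N := by simp [Matrix.mul_apply, smul_smul, mul_comm]
  map_zero' := by simp
  map_add' M N := by simp [add_smul]
  commutes' c := by simp [Algebra.algebraMap_eq_smul_one]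
  map_star' M := by simp

theorem trace_scalarHom_mul (M : Matrix Unit Unit ℂ) (Q : Matrix H H ℂ) :
    (scalarHom M * Q).trace = (M * traceMap Q).trace := by
  change ((M () () • (1 : Matrix H H ℂ)) * Q).trace = _
  simp [Matrix.trace, Matrix.mul_apply, traceMap, Finset.mul_sum]

theorem scalar_posDef {c : ℝ} (hc : 0 < c) : (scalar c).PosDef := by
  have : scalar c = Matrix.diagonal fun _ => (c : ℂ) := by
    ext
    simp [scalar]
  rw [this]
  exact Matrix.PosDef.diagonal fun _ => by exact_mod_cast hc

theorem scalar_posSemidef {c : ℝ} (hc : 0 ≤ c) : (scalar c).PosSemidef := by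
  rcases hc.eq_or_lt with rfl | hc
  · have : scalar 0 = 0 := by
      ext
      simp [scalar]
    rw [this]
    exact .zero
  · exact (scalar_posDef hc).posSemidef

/-- The `1 × 1` mean `y` need not be computed: the Riccati equation reads `y² Tr P = c`, and the
Gamma map is `y² P`. -/
theorem gammaMap_traceMap [Nonempty H] {P : Matrix H H ℂ} (hP : P.PosDef) {c : ℝ} (hc : 0 ≤ c) :
    gammaMap traceMap (scalar c) P = ((c : ℂ) / P.trace) • P := by
  have hR := congrFun₂ (geomMean_inv_conj trace_scalarHom_mul hP (scalar_posSemidef hc)) () ()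
  rw [gammaMap_eq trace_scalarHom_mul]
  generalize geomMean (traceMap P)⁻¹ (scalar c) = Y at *
  change Y () () • (1 : Matrix H H ℂ) * P * Y () () • (1 : Matrix H H ℂ) = _
  have ht : P.trace ≠ 0 := hP.trace_pos.ne'
  simp only [Matrix.mul_apply, traceMap, scalar, LinearMap.coe_mk, AddHom.coe_mk,
    Matrix.of_apply, Finset.univ_unique, Finset.sum_singleton] at hR
  rw [smul_mul_assoc, one_mul, mul_smul_comm, mul_one, smul_smul]
  congr 1
  rw [eq_div_iff ht, ← hR]
  simp only [PUnit.default_eq_unit]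
  ring

theorem fidelityProjection_traceMap [Nonempty H] {P : Matrix H H ℂ} (hP : P.PosDef) {c : ℝ}
    (hc : 0 ≤ c) :
    fidelityProjection traceMap (scalar c) P = {((c : ℂ) / P.trace) • P} := by
  rw [← gammaMap_traceMap hP hc]
  rcases hc.eq_or_lt with rfl | hc'
  · rw [gammaMap_traceMap hP le_rfl]
    ext Q
    simp [fidelityProjection, feasible_traceMap_zero]
    rintro rfl
    exact le_rfl
  · exact fidelityProjection_eq_gammaMap trace_scalarHom_mul hP (scalar_posDef hc')

end Trace

end BuresProj

open BuresProj in
theorem theorem3p3 :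
    -- Marginal projection for a multipartite system, onto the `k`-th factor.
    (∀ (n : ℕ) (X : Fin n → Type*) [∀ i, Fintype (X i)] [∀ i, DecidableEq (X i)]
      [∀ i, Nonempty (X i)] (k : Fin n)
      (P : Matrix (∀ i, X i) (∀ i, X i) ℂ) (C : Matrix (X k) (X k) ℂ),
      P.PosDef → C.PosDef →
        gammaMap (marginal k) C P
            = starMul P (tensorId k (geomMean (marginal k P)⁻¹ C) ^ 2) ∧
        gammaMap (marginal k) C P = starAt k P (geomMean (marginal k P)⁻¹ C ^ 2) ∧
        gammaMap (marginal k) C P ∈ feasible (marginal k) C ∧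
        buresProjection (marginal k) C P = {starAt k P (geomMean (marginal k P)⁻¹ C ^ 2)} ∧
        fidelityProjection (marginal k) C P = {starAt k P (geomMean (marginal k P)⁻¹ C ^ 2)}) ∧
    -- The bipartite case, and its instance `C = I`.
    (∀ (X Y : Type*) [Fintype X] [DecidableEq X] [Nonempty X]
      [Fintype Y] [DecidableEq Y] [Nonempty Y] (P : Matrix (X × Y) (X × Y) ℂ),
      P.PosDef →
        (∀ C : Matrix X X ℂ, C.PosDef →
          gammaMap marginalX C P = starX P (geomMean (marginalX P)⁻¹ C ^ 2) ∧
          buresProjection marginalX C P = {starX P (geomMean (marginalX P)⁻¹ C ^ 2)} ∧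
          fidelityProjection marginalX C P = {starX P (geomMean (marginalX P)⁻¹ C ^ 2)}) ∧
        gammaMap marginalX 1 P = starX P (marginalX P)⁻¹ ∧
        buresProjection marginalX 1 P = {starX P (marginalX P)⁻¹} ∧
        fidelityProjection marginalX 1 P = {starX P (marginalX P)⁻¹}) ∧
    -- Trace normalization, the case of a one-dimensional target `K = ℂ`.
    (∀ (H : Type*) [Fintype H] [DecidableEq H] [Nonempty H] (P : Matrix H H ℂ) (c : ℝ),
      P.PosDef → 0 ≤ c →
        gammaMap traceMap (scalar c) P = ((c : ℂ) / P.trace) • P ∧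
        buresProjection traceMap (scalar c) P = {((c : ℂ) / P.trace) • P} ∧
        fidelityProjection traceMap (scalar c) P = {((c : ℂ) / P.trace) • P}) := by
  refine ⟨?_, ?_, ?_⟩
  · intro n X _ _ _ k P C hP hC
    have hJ := trace_tensorId_mul (X := X) k
    have hstar : gammaMap (marginal k) C P = starAt k P (geomMean (marginal k P)⁻¹ C ^ 2) :=
      gammaMap_eq_starMul hJ P C
    refine ⟨?_, hstar, gammaMap_mem_feasible hJ hP hC.posSemidef, ?_, ?_⟩
    · rw [gammaMap, hsAdjoint_eq hJ]
      rfl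
    · rw [← hstar, buresProjection_eq_gammaMap hJ hP hC]
    · rw [← hstar, fidelityProjection_eq_gammaMap hJ hP hC]
  · intro X Y _ _ _ _ _ _ P hP
    have hJ := trace_kronecker_one_mul (X := X) (Y := Y)
    have main : ∀ C : Matrix X X ℂ, C.PosDef →
        gammaMap marginalX C P = starX P (geomMean (marginalX P)⁻¹ C ^ 2) ∧
        buresProjection marginalX C P = {starX P (geomMean (marginalX P)⁻¹ C ^ 2)} ∧
        fidelityProjection marginalX C P = {starX P (geomMean (marginalX P)⁻¹ C ^ 2)} := by
      intro C hC
      have hstar : gammaMap marginalX C P = starX P (geomMean (marginalX P)⁻¹ C ^ 2) :=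
        gammaMap_eq_starMul hJ P C
      refine ⟨hstar, ?_, ?_⟩
      · rw [← hstar, buresProjection_eq_gammaMap hJ hP hC]
      · rw [← hstar, fidelityProjection_eq_gammaMap hJ hP hC]
    refine ⟨main, ?_⟩
    have h1 := main 1 Matrix.PosDef.one
    rwa [geomMean_one_sq (posDef_of_trace_eq hJ hP).inv] at h1
  · intro H _ _ _ P c hP hc
    refine ⟨gammaMap_traceMap hP hc, ?_, fidelityProjection_traceMap hP hc⟩
    rw [buresProjection_eq_fidelityProjection fun Q hQ =>
      trace_of_mem_feasible trace_scalarHom_mul hQ, fidelityProjection_traceMap hP hc]
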